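/- **Setting.** Let $d\ge 1$, let $\mathcal H$ be a separable complex Hilbert space, and let $\mathcal F=\mathcal H\otimes\mathcal F_{\mathrm b}(L^2(\mathbb R^d))\cong\bigoplus_{n\ge0}L^2_{\mathrm{sym}}((\mathbb R^d)^n;\mathcal H)$, where $\mathcal F_{\mathrm b}$ is the boson Fock space. Inner products are linear in the second argument. Let $A$ be a self-adjoint operator in $\mathcal H$ that is bounded from below, and let $\omega:\mathbb R^d\to[0,\infty)$ be continuous with $\omega(k)>0$ for $k\neq0$ and $\inf_{|k|>\varepsilon}\omega(k)>0$ for every $\varepsilon>0$. Put $H_0=A\otimes I+I\otimes d\Gamma(\omega)$ on $D(A\otimes I)\cap D(I\otimes d\Gamma(\omega))$. Let $H_{\mathrm I}$ be an operator in $\mathcal F$ such that $H_{\rm QFT}=H_0+H_{\mathrm I}$, with domain $D(H_0)\cap D(H_{\mathrm I})$, is self-adjoint. Put $E_0=\inf\sigma(H_{\rm QFT})$ and $\widehat H_{\rm QFT}=H_{\rm QFT}-E_0$. A *ground state* is a vector $\Psi\ne0$ with $\widehat H_{\rm QFT}\Psi=0$ (in particular, it is understood that $E_0>-\infty$). Assume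 that there is a ground state $\Psi_{\rm QFT}$ and that $(B_{\rm PT}(k))_{k\in\mathbb R^d\setminus\{0\}}$ is a family of operators in $\mathcal F$ with the following properties. 1. $D(B_{\rm PT}(k))\supset D(H_0)$ for every $k\ne0$. The function $k\mapsto(\Phi,B_{\rm PT}(k)\Psi)_{\mathcal F}$ is measurable for all $\Psi\in D(H_0)$ and $\Phi\in\mathcal F$. The pull-through formula $$a(f)\Psi_{\rm QFT}=-\int_{\mathbb R^d}\overline{f(k)}\,(\widehat H_{\rm QFT}+\omega(k))^{-1}B_{\rm PT}(k)\Psi_{\rm QFT}\,dk$$ holds for every $f\in C_0^\infty(\mathbb R^d\setminus\{0\})$, where $a(f)$ is the annihilation operator. That is, $\Psi_{\rm QFT}\in D(a(f))$, the integrand is integrable, and the two sides are equal. 2. $(\widehat H_{\rm QFT}+\omega(k))^{-1}B_{\rm PT}(k)$ is bounded for every $k\neq0$, and $\int_{|k|>\varepsilon}\|(\widehat H_{\rm QFT}+\omega(k))^{-1}B_{\rm PT}(k)\|^2dk<\infty$ for every $\varepsilon>0$. Let $T_{\rm PT}:\mathcal F\to L^2(\mathbb R^d)$ be the maximal Carleman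 operator induced by $K_{\rm PT}(k)=(\widehat H_{\rm QFT}+\omega(k))^{-1}B_{\rm PT}(k)\Psi_{\rm QFT}$, that is, $(T_{\rm PT}\Phi)(k)=(K_{\rm PT}(k),\Phi)_{\mathcal F}$ with $$D(T_{\rm PT})=\{\Phi\in\mathcal F:\ (K_{\rm PT}(\cdot),\Phi)_{\mathcal F}\in L^2(\mathbb R^d)\}.$$ **Theorem.** If, moreover, $B_{\rm PT}(k)$ is a bounded operator on $\mathcal F$ for every $k\in\mathbb R^d\setminus\{0\}$ and $\|B_{\rm PT}(\cdot)\|_{\mathcal B(\mathcal F)}\in L^2(\mathbb R^d)$, then $$R(\widehat H_{\rm QFT})=\{\widehat H_{\rm QFT}\Psi:\Psi\in D(\widehat H_{\rm QFT})\}\subset D(T_{\rm PT}).$$ -/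

import Mathlib

open MeasureTheory

open scoped ENNReal

noncomputable section

namespace BoseField

/-! ## Unbounded operators in a Hilbert space -/

section Operators

variable {E F : Type*} [NormedAddCommGroup E] [InnerProductSpace ℂ E]
  [NormedAddCommGroup F] [InnerProductSpace ℂ F]

/-- `T + c`, with the same domain as `T`. -/
def addConst (T : E →ₗ.[ℂ] E) (c : ℂ) : E →ₗ.[ℂ] E :=
  (c • (LinearMap.id : E →ₗ[ℂ] E)) +ᵥ T

/-- The bounded, everywhere defined operator `R` is the two-sided inverse `(T - z)⁻¹`. -/
def IsResolventAt (T : E →ₗ.[ℂ] E) (z : ℂ) (R : E →L[ℂ] E) : Prop :=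
  (∀ y : E, ∃ h : R y ∈ T.domain, T ⟨R y, h⟩ - z • R y = y) ∧
    ∀ x : T.domain, R (T x - z • (x : E)) = x

/-- The resolvent set of an operator. -/
def resolventSet (T : E →ₗ.[ℂ] E) : Set ℂ := {z | ∃ R : E →L[ℂ] E, IsResolventAt T z R}

/-- The spectrum of an operator. -/
def spectrum (T : E →ₗ.[ℂ] E) : Set ℂ := (resolventSet T)ᶜ

open scoped Classical in
/-- The resolvent `(T - z)⁻¹` (by convention `0` when `z` lies in the spectrum). -/
def resolvent (T : E →ₗ.[ℂ] E) (z : ℂ) : E →L[ℂ] E :=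
  if h : z ∈ resolventSet T then h.choose else 0

theorem resolvent_spec {T : E →ₗ.[ℂ] E} {z : ℂ} (h : z ∈ resolventSet T) :
    IsResolventAt T z (resolvent T z) := by
  unfold resolvent
  rw [dif_pos h]
  exact h.choose_spec

/-- The spectrum of `T` intersected with the real line; all of it if `T` is self-adjoint. -/
def realSpectrum (T : E →ₗ.[ℂ] E) : Set ℝ := {x | (x : ℂ) ∈ spectrum T}

/-- The ground state energy `inf σ(T)`; used only when the spectrum is bounded below. -/
def groundStateEnergy (T : E →ₗ.[ℂ] E) : ℝ := sInf (realSpectrum T)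

/-- `T̂ = T - inf σ(T)`. -/
def hat (T : E →ₗ.[ℂ] E) : E →ₗ.[ℂ] E := addConst T (-(groundStateEnergy T : ℂ))

/-- `Ψ` is a ground state of `T`: `inf σ(T)` is finite and `Ψ` is a nonzero vector in the kernel of
`T - inf σ(T)`. -/
def IsGroundState (T : E →ₗ.[ℂ] E) (Ψ : E) : Prop :=
  BddBelow (realSpectrum T) ∧ Ψ ≠ 0 ∧
    ∃ h : Ψ ∈ (hat T).domain, hat T ⟨Ψ, h⟩ = 0

/-- `T` is bounded from below as a quadratic form. -/
def IsBoundedBelow (T : E →ₗ.[ℂ] E) : Prop :=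
  ∃ m : ℝ, ∀ x : T.domain, m * ‖(x : E)‖ ^ 2 ≤ (inner ℂ (x : E) (T x)).re

/-- The operator norm `sup {‖T x‖ : x ∈ D(T), ‖x‖ ≤ 1}`, equal to `∞` if `T` is unbounded. -/
def opNorm (T : E →ₗ.[ℂ] F) : ℝ≥0∞ := ⨆ x : {x : T.domain // ‖(x : E)‖ ≤ 1}, ‖T x.1‖ₑ

/-- `T` is a bounded operator on the whole space. -/
def IsBoundedOperator (T : E →ₗ.[ℂ] F) : Prop := T.domain = ⊤ ∧ opNorm T < ∞

open scoped Classical in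
/-- The value `T x` (by convention `0` outside the domain of `T`). -/
def value (T : E →ₗ.[ℂ] F) (x : E) : F := if h : x ∈ T.domain then T ⟨x, h⟩ else 0

/-- The range of an operator. -/
def range (T : E →ₗ.[ℂ] F) : Submodule ℂ F := LinearMap.range T.toFun

end Operators

/-! ## The state space `𝓕 = 𝓗 ⊗ 𝓕_b(L²(ℝᵈ))`, realised as `⨁ₙ L²_sym((ℝᵈ)ⁿ; 𝓗)` -/

/-- Momentum space `ℝᵈ`. -/
abbrev Mom (d : ℕ) : Type := EuclideanSpace ℝ (Fin d)

section Fock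

variable (d : ℕ) (𝓗 : Type*) [NormedAddCommGroup 𝓗] [InnerProductSpace ℂ 𝓗]

theorem measurePreserving_perm (n : ℕ) (σ : Equiv.Perm (Fin n)) :
    MeasurePreserving (fun k : Fin n → Mom d => k ∘ σ) volume volume := by
  have h := volume_measurePreserving_piCongrLeft (fun _ : Fin n => Mom d) σ.symm
  have e : (fun k : Fin n → Mom d => k ∘ σ) =
      MeasurableEquiv.piCongrLeft (fun _ : Fin n => Mom d) σ.symm := by
    funext k i
    obtain ⟨j, rfl⟩ := σ.symm.surjective i
    rw [MeasurableEquiv.coe_piCongrLeft, Equiv.piCongrLeft_apply_apply]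
    simp
  rw [e]
  exact h

/-- `L²_sym((ℝᵈ)ⁿ; 𝓗)`: the square-integrable `𝓗`-valued functions of `n` momenta that are
invariant under permutations of the momenta. For `n = 0` this is a copy of `𝓗`. -/
def symL2 (n : ℕ) : Submodule ℂ (Lp 𝓗 2 (volume : Measure (Fin n → Mom d))) where
  carrier := {f | ∀ σ : Equiv.Perm (Fin n), ∀ᵐ k : Fin n → Mom d, f (k ∘ σ) = f k}
  zero_mem' := by
    intro σ
    have h0 := Lp.coeFn_zero 𝓗 2 (volume : Measure (Fin n → Mom d))
    have h1 := (measurePreserving_perm d n σ).quasiMeasurePreserving.ae h0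
    filter_upwards [h0, h1] with k a b
    rw [a, b]; rfl
  add_mem' := by
    intro f g hf hg σ
    have h0 := Lp.coeFn_add f g
    have h1 := (measurePreserving_perm d n σ).quasiMeasurePreserving.ae h0
    filter_upwards [h0, h1, hf σ, hg σ] with k a b c e
    rw [a, b, Pi.add_apply, Pi.add_apply, c, e]
  smul_mem' := by
    intro c f hf σ
    have h0 := Lp.coeFn_smul c f
    have h1 := (measurePreserving_perm d n σ).quasiMeasurePreserving.ae h0
    filter_upwards [h0, h1, hf σ] with k a b e
    rw [a, b, Pi.smul_apply, Pi.smul_apply, e]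

theorem isClosed_symL2 (n : ℕ) :
    IsClosed (symL2 d 𝓗 n : Set (Lp 𝓗 2 (volume : Measure (Fin n → Mom d)))) := by
  have e : (symL2 d 𝓗 n : Set (Lp 𝓗 2 (volume : Measure (Fin n → Mom d)))) =
      ⋂ σ : Equiv.Perm (Fin n),
        {f | Lp.compMeasurePreserving _ (measurePreserving_perm d n σ) f = f} := by
    ext f
    rw [Set.mem_iInter]
    refine forall_congr' fun σ => ?_
    have h := Lp.coeFn_compMeasurePreserving f (measurePreserving_perm d n σ)
    constructor
    · intro hf
      exact Lp.ext (h.trans hf)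
    · intro hf
      rw [hf] at h
      exact h.symm
  rw [e]
  refine isClosed_iInter fun σ => isClosed_eq ?_ continuous_id
  exact (Lp.isometry_compMeasurePreserving (measurePreserving_perm d n σ)).continuous

instance instCompleteSpaceSymL2 [CompleteSpace 𝓗] (n : ℕ) : CompleteSpace (symL2 d 𝓗 n) :=
  (isClosed_symL2 d 𝓗 n).completeSpace_coe

/-- The state space `𝓕 = ⨁ₙ L²_sym((ℝᵈ)ⁿ; 𝓗)` (Hilbert space direct sum). -/
abbrev Fock : Type _ := lp (fun n : ℕ => symL2 d 𝓗 n) 2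

variable {d 𝓗}

/-- The `n`-particle component `Ψ⁽ⁿ⁾ : (ℝᵈ)ⁿ → 𝓗` of a state, as a function (defined a.e.). -/
def component (Ψ : Fock d 𝓗) (n : ℕ) : (Fin n → Mom d) → 𝓗 :=
  ((Ψ n : symL2 d 𝓗 n) : Lp 𝓗 2 (volume : Measure (Fin n → Mom d)))

theorem component_zero (n : ℕ) :
    ∀ᵐ k : Fin n → Mom d, component (0 : Fock d 𝓗) n k = 0 :=
  Lp.coeFn_zero 𝓗 2 (volume : Measure (Fin n → Mom d))

theorem component_add (Ψ Φ : Fock d 𝓗) (n : ℕ) :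
    ∀ᵐ k : Fin n → Mom d, component (Ψ + Φ) n k = component Ψ n k + component Φ n k :=
  Lp.coeFn_add ((Ψ n : symL2 d 𝓗 n) : Lp 𝓗 2 (volume : Measure (Fin n → Mom d))) (Φ n).1

theorem component_smul (c : ℂ) (Ψ : Fock d 𝓗) (n : ℕ) :
    ∀ᵐ k : Fin n → Mom d, component (c • Ψ) n k = c • component Ψ n k :=
  Lp.coeFn_smul c ((Ψ n : symL2 d 𝓗 n) : Lp 𝓗 2 (volume : Measure (Fin n → Mom d)))

theorem eq_zero_of_component {Ψ : Fock d 𝓗}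
    (h : ∀ n, ∀ᵐ k : Fin n → Mom d, component Ψ n k = 0) : Ψ = 0 := by
  apply lp.ext
  funext n
  apply Subtype.ext
  refine Lp.ext ?_
  filter_upwards [h n, Lp.coeFn_zero 𝓗 2 (volume : Measure (Fin n → Mom d))] with k a b
  exact a.trans b.symm

/-- A property that holds at almost every `(n+1)`-tuple of momenta holds at `(q, k₁, …, kₙ)` for
almost every `(k₁, …, kₙ)` and almost every `q`. -/
theorem ae_ae_cons {n : ℕ} {p : (Fin (n + 1) → Mom d) → Prop}
    (h : ∀ᵐ k : Fin (n + 1) → Mom d, p k) :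
    ∀ᵐ k : Fin n → Mom d, ∀ᵐ q : Mom d, p (Fin.cons q k) := by
  have h1 := (volume_preserving_piFinSuccAbove (fun _ : Fin (n + 1) => Mom d) 0).symm
  have h2 := h1.quasiMeasurePreserving.ae h
  have h3 := (Measure.measurePreserving_swap (μ := (volume : Measure (Fin n → Mom d)))
    (ν := (volume : Measure (Mom d)))).quasiMeasurePreserving.ae h2
  have h4 := Measure.ae_ae_of_ae_prod h3
  filter_upwards [h4] with k hk
  filter_upwards [hk] with q hq
  simpa [MeasurableEquiv.piFinSuccAbove, Fin.insertNthEquiv] using hq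

/-- The graph of `A ⊗ I`: `A` acts on the value of every component at almost every point. -/
def tensorIdGraph (A : 𝓗 →ₗ.[ℂ] 𝓗) : Submodule ℂ (Fock d 𝓗 × Fock d 𝓗) where
  carrier := {p | ∀ n, ∀ᵐ k : Fin n → Mom d, (component p.1 n k, component p.2 n k) ∈ A.graph}
  zero_mem' := by
    intro n
    filter_upwards [component_zero (d := d) (𝓗 := 𝓗) n] with k a
    change (component (0 : Fock d 𝓗) n k, component (0 : Fock d 𝓗) n k) ∈ A.graph
    rw [a]
    exact A.graph.zero_mem
  add_mem' := by
    intro p q hp hq n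
    filter_upwards [hp n, hq n, component_add p.1 q.1 n, component_add p.2 q.2 n] with k a b c e
    rw [Prod.fst_add, Prod.snd_add, c, e]
    exact A.graph.add_mem a b
  smul_mem' := by
    intro c p hp n
    filter_upwards [hp n, component_smul c p.1 n, component_smul c p.2 n] with k a b e
    rw [Prod.smul_fst, Prod.smul_snd, b, e]
    exact A.graph.smul_mem c a

theorem tensorIdGraph_functional (A : 𝓗 →ₗ.[ℂ] 𝓗) (p : Fock d 𝓗 × Fock d 𝓗)
    (hp : p ∈ tensorIdGraph A) (h : p.1 = 0) : p.2 = 0 := by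
  refine eq_zero_of_component fun n => ?_
  filter_upwards [hp n, component_zero (d := d) (𝓗 := 𝓗) n] with k a b
  rw [h, b] at a
  exact A.graph_fst_eq_zero_snd a rfl

/-- The operator `A ⊗ I` on its maximal domain (for self-adjoint `A`, the closure of the algebraic
tensor product of `A` and `I`). -/
def tensorId (A : 𝓗 →ₗ.[ℂ] 𝓗) : Fock d 𝓗 →ₗ.[ℂ] Fock d 𝓗 := (tensorIdGraph A).toLinearPMap

/-- The graph of `I ⊗ dΓ(ω)`: multiplication of `Ψ⁽ⁿ⁾(k₁, …, kₙ)` by `ω(k₁) + ⋯ + ω(kₙ)`. -/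
def secondQuantGraph (ω : Mom d → ℝ) : Submodule ℂ (Fock d 𝓗 × Fock d 𝓗) where
  carrier := {p | ∀ n, ∀ᵐ k : Fin n → Mom d,
    component p.2 n k = ((∑ j, ω (k j) : ℝ) : ℂ) • component p.1 n k}
  zero_mem' := by
    intro n
    filter_upwards [component_zero (d := d) (𝓗 := 𝓗) n] with k a
    change component (0 : Fock d 𝓗) n k = _ • component (0 : Fock d 𝓗) n k
    rw [a, smul_zero]
  add_mem' := by
    intro p q hp hq n
    filter_upwards [hp n, hq n, component_add p.1 q.1 n, component_add p.2 q.2 n] with k a b c e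
    rw [Prod.fst_add, Prod.snd_add, c, e, a, b, smul_add]
  smul_mem' := by
    intro c p hp n
    filter_upwards [hp n, component_smul c p.1 n, component_smul c p.2 n] with k a b e
    rw [Prod.smul_fst, Prod.smul_snd, b, e, a, smul_comm]

theorem secondQuantGraph_functional (ω : Mom d → ℝ) (p : Fock d 𝓗 × Fock d 𝓗)
    (hp : p ∈ secondQuantGraph ω) (h : p.1 = 0) : p.2 = 0 := by
  refine eq_zero_of_component fun n => ?_
  filter_upwards [hp n, component_zero (d := d) (𝓗 := 𝓗) n] with k a b
  rw [a, h, b, smul_zero]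

/-- The operator `I ⊗ dΓ(ω)`, the second quantization of multiplication by `ω`. -/
def secondQuant (ω : Mom d → ℝ) : Fock d 𝓗 →ₗ.[ℂ] Fock d 𝓗 := (secondQuantGraph ω).toLinearPMap

/-- The graph of the annihilation operator `a(f) = I ⊗ a_b(f)`:
`(a(f)Ψ)⁽ⁿ⁾(k₁, …, kₙ) = √(n+1) ∫ conj (f q) Ψ⁽ⁿ⁺¹⁾(q, k₁, …, kₙ) dq`.
(The integrability clause is automatic when `f` is square-integrable.) -/
def annihilationGraph (f : Mom d → ℂ) : Submodule ℂ (Fock d 𝓗 × Fock d 𝓗) where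
  carrier := {p | ∀ n, ∀ᵐ k : Fin n → Mom d,
    Integrable (fun q : Mom d => star (f q) • component p.1 (n + 1) (Fin.cons q k)) ∧
    component p.2 n k = ((Real.sqrt (n + 1) : ℝ) : ℂ) •
      ∫ q : Mom d, star (f q) • component p.1 (n + 1) (Fin.cons q k)}
  zero_mem' := by
    intro n
    filter_upwards [component_zero (d := d) (𝓗 := 𝓗) n,
      ae_ae_cons (component_zero (d := d) (𝓗 := 𝓗) (n + 1))] with k a b
    have e : (fun q : Mom d => star (f q) • component (0 : Fock d 𝓗) (n + 1) (Fin.cons q k))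
        =ᵐ[volume] fun _ => 0 := by
      filter_upwards [b] with q hq
      rw [hq, smul_zero]
    change Integrable (fun q : Mom d =>
        star (f q) • component (0 : Fock d 𝓗) (n + 1) (Fin.cons q k)) ∧
      component (0 : Fock d 𝓗) n k = ((Real.sqrt (n + 1) : ℝ) : ℂ) •
        ∫ q : Mom d, star (f q) • component (0 : Fock d 𝓗) (n + 1) (Fin.cons q k)
    refine ⟨(integrable_zero _ _ _).congr e.symm, ?_⟩
    rw [integral_congr_ae e, a, integral_zero, smul_zero]
  add_mem' := by
    intro p q hp hq n
    filter_upwards [hp n, hq n, component_add p.2 q.2 n,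
      ae_ae_cons (component_add p.1 q.1 (n + 1))] with k a b c e
    have e' : (fun x : Mom d => star (f x) • component (p + q).1 (n + 1) (Fin.cons x k))
        =ᵐ[volume] fun x => star (f x) • component p.1 (n + 1) (Fin.cons x k) +
          star (f x) • component q.1 (n + 1) (Fin.cons x k) := by
      filter_upwards [e] with x hx
      rw [Prod.fst_add, hx, smul_add]
    refine ⟨(a.1.add b.1).congr e'.symm, ?_⟩
    rw [integral_congr_ae e', integral_add a.1 b.1, Prod.snd_add, c, a.2, b.2, smul_add]
  smul_mem' := by
    intro c p hp n
    filter_upwards [hp n, component_smul c p.2 n,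
      ae_ae_cons (component_smul c p.1 (n + 1))] with k a b e
    have e' : (fun x : Mom d => star (f x) • component (c • p).1 (n + 1) (Fin.cons x k))
        =ᵐ[volume] fun x => c • (star (f x) • component p.1 (n + 1) (Fin.cons x k)) := by
      filter_upwards [e] with x hx
      rw [Prod.smul_fst, hx, smul_comm]
    refine ⟨(a.1.smul c).congr e'.symm, ?_⟩
    rw [integral_congr_ae e', integral_smul, Prod.smul_snd, b, a.2, smul_comm]

theorem annihilationGraph_functional (f : Mom d → ℂ) (p : Fock d 𝓗 × Fock d 𝓗)
    (hp : p ∈ annihilationGraph f) (h : p.1 = 0) : p.2 = 0 := by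
  refine eq_zero_of_component fun n => ?_
  filter_upwards [hp n, ae_ae_cons (component_zero (d := d) (𝓗 := 𝓗) (n + 1))] with k a b
  have e : (fun q : Mom d => star (f q) • component p.1 (n + 1) (Fin.cons q k))
      =ᵐ[volume] fun _ => 0 := by
    filter_upwards [b] with q hq
    rw [h, hq, smul_zero]
  rw [a.2, integral_congr_ae e, integral_zero, smul_zero]

/-- The annihilation operator `a(f)` on its maximal domain. -/
def annihilation (f : Mom d → ℂ) : Fock d 𝓗 →ₗ.[ℂ] Fock d 𝓗 := (annihilationGraph f).toLinearPMap

/-- The free Hamiltonian `H₀ = A ⊗ I + I ⊗ dΓ(ω)` with domain `D(A ⊗ I) ∩ D(I ⊗ dΓ(ω))`. -/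
def freeHamiltonian (A : 𝓗 →ₗ.[ℂ] 𝓗) (ω : Mom d → ℝ) : Fock d 𝓗 →ₗ.[ℂ] Fock d 𝓗 :=
  tensorId A + secondQuant ω

/-- The standing assumptions on the dispersion relation. -/
structure IsDispersion (ω : Mom d → ℝ) : Prop where
  continuous : Continuous ω
  nonneg : ∀ k, 0 ≤ ω k
  pos : ∀ k, k ≠ 0 → 0 < ω k
  inf_pos : ∀ ε : ℝ, 0 < ε → ∃ c : ℝ, 0 < c ∧ ∀ k, ε < ‖k‖ → c ≤ ω k

/-! ## The pull-through formula and the maximal Carleman operator -/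

/-- The inducing function `K(k) = (Ĥ + ω(k))⁻¹ B(k) Ψ` (`k ≠ 0`; the value at `k = 0` is
irrelevant). -/
def carlemanKernel (H : Fock d 𝓗 →ₗ.[ℂ] Fock d 𝓗) (ω : Mom d → ℝ)
    (B : Mom d → Fock d 𝓗 →ₗ.[ℂ] Fock d 𝓗) (Ψ : Fock d 𝓗) (k : Mom d) : Fock d 𝓗 :=
  resolvent (hat H) (-(ω k : ℂ)) (value (B k) Ψ)

/-- The operator-theoretical pull-through formula on the state `Ψ`:
`a(f)Ψ = - ∫ conj (f k) (Ĥ + ω(k))⁻¹ B(k) Ψ dk` for every `f ∈ C₀^∞(ℝᵈ ∖ {0})`. -/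
def PullThrough (H : Fock d 𝓗 →ₗ.[ℂ] Fock d 𝓗) (ω : Mom d → ℝ)
    (B : Mom d → Fock d 𝓗 →ₗ.[ℂ] Fock d 𝓗) (Ψ : Fock d 𝓗) : Prop :=
  ∀ f : Mom d → ℂ, ContDiff ℝ ((⊤ : ℕ∞) : WithTop ℕ∞) f → HasCompactSupport f → (0 : Mom d) ∉ tsupport f →
    ∃ h : Ψ ∈ (annihilation (𝓗 := 𝓗) f).domain,
      Integrable (fun k => star (f k) • carlemanKernel H ω B Ψ k) ∧
      annihilation f ⟨Ψ, h⟩ = -∫ k, star (f k) • carlemanKernel H ω B Ψ k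

/-- `B(k)`, `k ≠ 0`, is defined on the subspace `D`, and `B(·)Φ` is weakly measurable for `Φ ∈ D`. -/
def IsMeasurableFamily (D : Submodule ℂ (Fock d 𝓗))
    (B : Mom d → Fock d 𝓗 →ₗ.[ℂ] Fock d 𝓗) : Prop :=
  (∀ k, k ≠ 0 → D ≤ (B k).domain) ∧
    ∀ Φ ∈ D, ∀ Ξ : Fock d 𝓗, AEMeasurable (fun k => inner ℂ Ξ (value (B k) Φ)) volume

/-- `(Ĥ + ω(k))⁻¹ B(k)` is bounded for `k ≠ 0`, and its operator norm is square-integrable over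
`|k| > ε` for every `ε > 0`. -/
def IsRegularAwayFromZero (H : Fock d 𝓗 →ₗ.[ℂ] Fock d 𝓗) (ω : Mom d → ℝ)
    (B : Mom d → Fock d 𝓗 →ₗ.[ℂ] Fock d 𝓗) : Prop :=
  (∀ k, k ≠ 0 →
    opNorm ((resolvent (hat H) (-(ω k : ℂ))).toLinearMap.compPMap (B k)) < ∞) ∧
  ∀ ε : ℝ, 0 < ε → ∫⁻ k in {k : Mom d | ε < ‖k‖},
    opNorm ((resolvent (hat H) (-(ω k : ℂ))).toLinearMap.compPMap (B k)) ^ 2 < ∞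

end Fock

section Carleman

variable {d : ℕ} {E : Type*} [NormedAddCommGroup E] [InnerProductSpace ℂ E]

/-- The domain of the maximal Carleman operator induced by `K`: all `Φ` for which
`k ↦ (K(k), Φ)` is in `L²(ℝᵈ)`. -/
def carlemanDomain (K : Mom d → E) : Submodule ℂ (E) where
  carrier := {Φ | MemLp (fun k => inner ℂ (K k) Φ) 2 volume}
  zero_mem' := by
    change MemLp (fun k => inner ℂ (K k) (0 : E)) 2 volume
    simp only [inner_zero_right]
    exact MemLp.zero
  add_mem' := by
    intro Φ Ξ h1 h2
    change MemLp (fun k => inner ℂ (K k) (Φ + Ξ)) 2 volume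
    simp only [inner_add_right]
    exact MemLp.add h1 h2
  smul_mem' := by
    intro c Φ h
    change MemLp (fun k => inner ℂ (K k) (c • Φ)) 2 volume
    simp only [inner_smul_right]
    exact MemLp.const_smul h c

theorem mem_carlemanDomain {K : Mom d → E} {Φ : E} :
    Φ ∈ carlemanDomain K ↔ MemLp (fun k => inner ℂ (K k) Φ) 2 volume := Iff.rfl

/-- The maximal Carleman operator `T : E → L²(ℝᵈ)` induced by `K`: `(TΦ)(k) = (K(k), Φ)`. -/
def maximalCarleman (K : Mom d → E) :
    E →ₗ.[ℂ] Lp ℂ 2 (volume : Measure (Mom d)) where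
  domain := carlemanDomain K
  toFun :=
    { toFun := fun Φ => MemLp.toLp (fun k => inner ℂ (K k) (Φ : E))
        (mem_carlemanDomain.mp Φ.2)
      map_add' := by
        intro Φ Ξ
        have h1 := mem_carlemanDomain.mp Φ.2
        have h2 := mem_carlemanDomain.mp Ξ.2
        rw [← MemLp.toLp_add h1 h2]
        refine MemLp.toLp_congr _ _ (ae_of_all _ fun k => ?_)
        exact inner_add_right _ _ _
      map_smul' := by
        intro c Φ
        have h1 := mem_carlemanDomain.mp Φ.2
        rw [RingHom.id_apply, ← MemLp.toLp_const_smul c h1]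
        refine MemLp.toLp_congr _ _ (ae_of_all _ fun k => ?_)
        exact inner_smul_right _ _ _ }

end Carleman

end BoseField

end

/-!
Write `R(k) = (Ĥ + ω(k))⁻¹`. Since `R(k)` is self-adjoint, `(K(k), Ĥη) = (B(k)Ψ, R(k)Ĥη)`, and
`R(k)Ĥη = η - ω(k)R(k)η` has norm at most `2‖η‖` because `Ĥ ≥ 0` gives `‖R(k)‖ ≤ 1 / ω(k)`. Hence
`|(K(k), Ĥη)| ≤ 2‖η‖‖Ψ‖‖B(k)‖`, which is square-integrable: the singularity of `R(k)` at `ω(k) = 0`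
is absorbed by `Ĥ`. Measurability of the pairing holds because `B(·)Ψ` is weakly measurable and
`R(·)Ĥη`, a continuous function of `ω(k) > 0`, is strongly measurable.
-/

namespace BoseField

section Measurability

variable {α X Y : Type*} [MeasurableSpace α] {μ : Measure α}

theorem aemeasurable_apply_simpleFunc [MeasurableSpace Y] {f : X → α → Y}
    (hf : ∀ x, AEMeasurable (f x) μ) (s : SimpleFunc α X) :
    AEMeasurable (fun k => f (s k) k) μ := by
  have hmk : ∀ᵐ k ∂μ, ∀ x ∈ s.range, f x k = (hf x).mk (f x) k :=
    (ae_ball_iff s.range.countable_toSet).2 fun x _ => (hf x).ae_eq_mk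
  refine ⟨_, s.measurable_bind _ fun x => (hf x).measurable_mk, ?_⟩
  filter_upwards [hmk] with k hk
  exact hk (s k) (s.mem_range_self k)

theorem aemeasurable_apply_of_continuous [TopologicalSpace X] [TopologicalSpace Y]
    [TopologicalSpace.PseudoMetrizableSpace Y] [MeasurableSpace Y] [BorelSpace Y] {f : X → α → Y}
    (hf : ∀ x, AEMeasurable (f x) μ) (hcont : ∀ᵐ k ∂μ, Continuous fun x => f x k) {v : α → X}
    (hv : AEStronglyMeasurable v μ) : AEMeasurable (fun k => f (v k) k) μ := by
  obtain ⟨w, hw, hvw⟩ := hv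
  have hlim : AEMeasurable (fun k => f (w k) k) μ := by
    refine aemeasurable_of_tendsto_metrizable_ae Filter.atTop
      (fun n => aemeasurable_apply_simpleFunc hf (hw.approx n)) ?_
    filter_upwards [hcont] with k hk
    exact (hk.tendsto (w k)).comp (hw.tendsto_approx k)
  refine hlim.congr ?_
  filter_upwards [hvw] with k hk
  rw [hk]

theorem aestronglyMeasurable_inner_of_weak {𝕜 E : Type*} [RCLike 𝕜] [SeminormedAddCommGroup E]
    [InnerProductSpace 𝕜 E] {b v : α → E} (hb : ∀ x : E, AEMeasurable (fun k => inner 𝕜 x (b k)) μ)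
    (hv : AEStronglyMeasurable v μ) : AEStronglyMeasurable (fun k => inner 𝕜 (b k) (v k)) μ := by
  have hb' (x : E) : AEMeasurable (fun k => inner 𝕜 (b k) x) μ := by
    simpa only [Function.comp_def, inner_conj_symm] using
      RCLike.continuous_conj.measurable.comp_aemeasurable (hb x)
  exact (aemeasurable_apply_of_continuous hb' (ae_of_all _ fun k => by fun_prop)
    hv).aestronglyMeasurable

end Measurability

section Operators

variable {E F : Type*} [NormedAddCommGroup E] [InnerProductSpace ℂ E] [NormedAddCommGroup F]
  [InnerProductSpace ℂ F]

theorem enorm_value_le (T : E →ₗ.[ℂ] F) (x : E) : ‖value T x‖ₑ ≤ opNorm T * ‖x‖ₑ := by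
  by_cases hx : x ∈ T.domain
  swap
  · simp [value, hx]
  rcases eq_or_ne x 0 with rfl | h0
  · simp [value, show (⟨0, hx⟩ : T.domain) = 0 from rfl]
  have hn : (‖x‖ : ℂ) ≠ 0 := Complex.ofReal_ne_zero.2 (norm_ne_zero_iff.2 h0)
  set u : T.domain := (‖x‖ : ℂ)⁻¹ • ⟨x, hx⟩
  have hu : ‖(u : E)‖ ≤ 1 := (norm_smul_inv_norm (𝕜 := ℂ) h0).le
  have hxu : (⟨x, hx⟩ : T.domain) = (‖x‖ : ℂ) • u := (smul_inv_smul₀ hn _).symm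
  calc ‖value T x‖ₑ = ‖T u‖ₑ * ‖x‖ₑ := by
        rw [value, dif_pos hx, hxu, LinearPMap.map_smul, enorm_smul, mul_comm,
          ← ofReal_norm (_ : ℂ), Complex.norm_real, norm_norm, ofReal_norm]
    _ ≤ opNorm T * ‖x‖ₑ := by
        gcongr
        exact le_iSup (fun y : {y : T.domain // ‖(y : E)‖ ≤ 1} => ‖T y.1‖ₑ) ⟨u, hu⟩

theorem norm_value_le {T : E →ₗ.[ℂ] F} (hT : opNorm T ≠ ∞) (x : E) :
    ‖value T x‖ ≤ (opNorm T).toReal * ‖x‖ := by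
  have h := ENNReal.toReal_mono (ENNReal.mul_ne_top hT enorm_ne_top) (enorm_value_le T x)
  simpa only [ENNReal.toReal_mul, toReal_enorm] using h

theorem isFormalAdjoint_addConst {T : E →ₗ.[ℂ] E} (hT : T.IsFormalAdjoint T) (c : ℝ) :
    (addConst T c).IsFormalAdjoint (addConst T c) := by
  intro x y
  have hxy : inner ℂ (T x) (y : E) = inner ℂ (x : E) (T y) := hT x y
  change inner ℂ ((c : ℂ) • (x : E) + T x) (y : E) = inner ℂ (x : E) ((c : ℂ) • (y : E) + T y)
  rw [inner_add_left, inner_add_right, inner_smul_left, inner_smul_right, hxy, Complex.conj_ofReal]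

end Operators

section Resolvents

variable {E : Type*} [NormedAddCommGroup E] [InnerProductSpace ℂ E] {T : E →ₗ.[ℂ] E}
  {R S : E →L[ℂ] E} {z w : ℂ}

namespace IsResolventAt

theorem addConst {c : ℂ} (hR : IsResolventAt T (z - c) R) :
    IsResolventAt (addConst T c) z R := by
  refine ⟨fun y => ?_, fun x => ?_⟩
  · obtain ⟨hy, hTy⟩ := hR.1 y
    refine ⟨hy, ?_⟩
    change (c • R y + T ⟨R y, hy⟩) - z • R y = y
    linear_combination (norm := module) hTy
  · have hRx := hR.2 x
    change R ((c • (x : E) + T x) - z • (x : E)) = x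
    rwa [show c • (x : E) + T x - z • (x : E) = T x - (z - c) • (x : E) by module]

theorem apply_apply (hR : IsResolventAt T z R) (x : T.domain) : R (T x) = x + z • R x := by
  rw [← sub_eq_iff_eq_add, ← map_smul, ← map_sub]
  exact hR.2 x

theorem sub_eq_smul_mul (hR : IsResolventAt T z R) (hS : IsResolventAt T w S) :
    R - S = (z - w) • (R * S) := by
  ext y
  obtain ⟨hy, hTy⟩ := hS.1 y
  have hRTS : R (T ⟨S y, hy⟩) = S y + z • R (S y) := hR.apply_apply ⟨S y, hy⟩
  rw [eq_add_of_sub_eq hTy, map_add, map_smul] at hRTS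
  change R y - S y = (z - w) • R (S y)
  linear_combination (norm := module) hRTS

theorem one_sub_smul_mul_one_add_smul (hR : IsResolventAt T z R) (hS : IsResolventAt T w S) :
    (1 - (w - z) • R) * (1 + (w - z) • S) = 1 := by
  have hRS : R = S + (z - w) • (R * S) := sub_eq_iff_eq_add'.1 (hR.sub_eq_smul_mul hS)
  simp only [sub_mul, mul_add, one_mul, mul_one, smul_mul_assoc, mul_smul_comm]
  linear_combination (norm := module) (z - w) • hRS

theorem isUnit_one_sub_smul (hR : IsResolventAt T z R) (hS : IsResolventAt T w S) :
    IsUnit (1 - (w - z) • R) := by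
  refine isUnit_iff_exists.2 ⟨1 + (w - z) • S, hR.one_sub_smul_mul_one_add_smul hS, ?_⟩
  have h := hS.one_sub_smul_mul_one_add_smul hR
  rwa [← neg_sub w z, neg_smul, neg_smul, sub_neg_eq_add, ← sub_eq_add_neg] at h

theorem eq_mul_inverse (hR : IsResolventAt T z R) (hS : IsResolventAt T w S) :
    S = R * Ring.inverse (1 - (w - z) • R) := by
  rw [Ring.eq_mul_inverse_iff_mul_eq _ _ _ (hR.isUnit_one_sub_smul hS), mul_sub, mul_one,
    mul_smul_comm, ← hS.sub_eq_smul_mul hR, sub_sub_cancel]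

theorem notMem_spectrum (hR : IsResolventAt T z R) {m : ℂ} (hm : m ≠ 0)
    (hz : z + m⁻¹ ∈ resolventSet T) : m ∉ _root_.spectrum ℂ R := by
  obtain ⟨S, hS⟩ := hz
  have hunit := (hR.isUnit_one_sub_smul hS).smul (Units.mk0 m hm)
  rw [spectrum.notMem_iff]
  convert hunit using 1
  rw [add_sub_cancel_left, Units.smul_mk0, smul_sub, smul_inv_smul₀ hm,
    Algebra.algebraMap_eq_smul_one]

theorem isSymmetric (hT : T.IsFormalAdjoint T) {a : ℝ} (hR : IsResolventAt T a R) :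
    R.IsSymmetric := by
  intro x y
  obtain ⟨hx, hTx⟩ := hR.1 x
  obtain ⟨hy, hTy⟩ := hR.1 y
  have hxy : inner ℂ (T ⟨R x, hx⟩) (R y) = inner ℂ (R x) (T ⟨R y, hy⟩) := hT ⟨R x, hx⟩ ⟨R y, hy⟩
  change inner ℂ (R x) y = inner ℂ x (R y)
  nth_rewrite 2 [← hTx]
  nth_rewrite 1 [← hTy]
  rw [inner_sub_left, inner_sub_right, inner_smul_left, inner_smul_right, hxy, Complex.conj_ofReal]

end IsResolventAt

theorem continuousOn_resolvent [CompleteSpace E] (T : E →ₗ.[ℂ] E) :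
    ContinuousOn (resolvent T) (resolventSet T) := by
  intro z hz
  have hR := resolvent_spec hz
  have hone : ContinuousAt Ring.inverse (1 - (z - z) • resolvent T z) := by
    simpa using NormedRing.inverse_continuousAt (1 : (E →L[ℂ] E)ˣ)
  have hneumann : ContinuousAt
      (fun w => resolvent T z * Ring.inverse (1 - (w - z) • resolvent T z)) z :=
    continuousAt_const.mul (hone.comp (f := fun w => 1 - (w - z) • resolvent T z) (by fun_prop))
  exact hneumann.continuousWithinAt.congr (fun w hw => hR.eq_mul_inverse (resolvent_spec hw))
    (hR.eq_mul_inverse hR)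

theorem ofReal_mem_resolventSet_hat (hT : BddBelow (realSpectrum T)) {x : ℝ} (hx : x < 0) :
    (x : ℂ) ∈ resolventSet (hat T) := by
  have hlt : x + groundStateEnergy T < sInf (realSpectrum T) := add_lt_of_neg_left _ hx
  obtain ⟨R, hR⟩ := not_not.mp (notMem_of_lt_csInf hlt hT)
  exact ⟨R, IsResolventAt.addConst (by simpa using hR)⟩

end Resolvents

section Nonnegative

variable {E : Type*} [NormedAddCommGroup E] [InnerProductSpace ℂ E] {T : E →ₗ.[ℂ] E}

/-- A nonnegative self-adjoint operator, described by what its resolvents require: `T` is symmetric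
and `(T + a)⁻¹` is a bounded operator for every `a > 0`. Density of the domain and self-adjointness
follow from these two properties. -/
structure IsNonnegative (T : E →ₗ.[ℂ] E) : Prop where
  isFormalAdjoint : T.IsFormalAdjoint T
  neg_mem_resolventSet : ∀ a : ℝ, 0 < a → -(a : ℂ) ∈ resolventSet T

theorem isNonnegative_hat (hT : T.IsFormalAdjoint T) (hbdd : BddBelow (realSpectrum T)) :
    IsNonnegative (hat T) where
  isFormalAdjoint := by
    simpa only [hat, Complex.ofReal_neg] using isFormalAdjoint_addConst hT (-groundStateEnergy T)
  neg_mem_resolventSet a ha := by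
    simpa only [Complex.ofReal_neg] using ofReal_mem_resolventSet_hat hbdd (neg_lt_zero.2 ha)

namespace IsNonnegative

theorem isResolventAt (hT : IsNonnegative T) {a : ℝ} (ha : 0 < a) :
    IsResolventAt T (-(a : ℂ)) (resolvent T (-(a : ℂ))) :=
  resolvent_spec (hT.neg_mem_resolventSet a ha)

theorem isSymmetric_resolvent (hT : IsNonnegative T) {a : ℝ} (ha : 0 < a) :
    (resolvent T (-(a : ℂ))).IsSymmetric :=
  IsResolventAt.isSymmetric (a := -a) hT.isFormalAdjoint (by simpa using hT.isResolventAt ha)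

variable [CompleteSpace E]

theorem norm_resolvent_le (hT : IsNonnegative T) {a : ℝ} (ha : 0 < a) :
    ‖resolvent T (-(a : ℂ))‖ ≤ a⁻¹ := by
  set R := resolvent T (-(a : ℂ))
  have hsa : IsSelfAdjoint R :=
    ContinuousLinearMap.isSelfAdjoint_iff_isSymmetric.2 (hT.isSymmetric_resolvent ha)
  have hspec : ∀ m ∈ _root_.spectrum ℝ R, |m| ≤ a⁻¹ := by
    intro m hm
    by_contra! hlt
    have hm0 : m ≠ 0 := abs_pos.1 ((inv_pos.2 ha).trans hlt)
    have hinv : m⁻¹ < a :=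
      (le_abs_self _).trans_lt (abs_inv m ▸ inv_lt_of_inv_lt₀ ha hlt)
    refine (hT.isResolventAt ha).notMem_spectrum (Complex.ofReal_ne_zero.2 hm0) ?_
      ((spectrum.algebraMap_mem_iff ℂ).2 hm)
    convert hT.neg_mem_resolventSet (a - m⁻¹) (sub_pos.2 hinv) using 1
    push_cast
    ring
  rw [← cfc_id ℝ R]
  exact norm_cfc_le (inv_pos.2 ha).le hspec

theorem norm_resolvent_apply_apply_le (hT : IsNonnegative T) {a : ℝ} (ha : 0 < a) (η : T.domain) :
    ‖resolvent T (-(a : ℂ)) (T η)‖ ≤ 2 * ‖(η : E)‖ := by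
  have hR : ‖(a : ℂ) • resolvent T (-(a : ℂ)) η‖ ≤ ‖(η : E)‖ := by
    rw [norm_smul, Complex.norm_of_nonneg ha.le, ← le_inv_mul_iff₀ ha]
    exact ContinuousLinearMap.le_of_opNorm_le _ (hT.norm_resolvent_le ha) _
  rw [(hT.isResolventAt ha).apply_apply, neg_smul, ← sub_eq_add_neg, two_mul]
  exact (norm_sub_le _ _).trans (add_le_add_right hR _)

variable {α : Type*} [MeasurableSpace α] {μ : Measure α} {ω : α → ℝ}

theorem aestronglyMeasurable_resolvent_apply (hT : IsNonnegative T) (hω : AEMeasurable ω μ)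
    (hpos : ∀ᵐ k ∂μ, 0 < ω k) (x : E) :
    AEStronglyMeasurable (fun k => resolvent T (-(ω k : ℂ)) x) μ := by
  have hcont : ContinuousOn (fun a : ℝ => resolvent T (-(a : ℂ)) x) (Set.Ioi 0) :=
    ((continuousOn_resolvent T).comp (by fun_prop) hT.neg_mem_resolventSet).clm_apply
      continuousOn_const
  have hmap : ∀ᵐ a ∂μ.map ω, a ∈ Set.Ioi (0 : ℝ) := (ae_map_iff hω measurableSet_Ioi).2 hpos
  have hmeas := hcont.aestronglyMeasurable (μ := μ.map ω) measurableSet_Ioi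
  rw [Measure.restrict_eq_self_of_ae_mem hmap] at hmeas
  exact hmeas.comp_aemeasurable hω

theorem memLp_inner_resolvent_apply (hT : IsNonnegative T) (hω : AEMeasurable ω μ)
    (hpos : ∀ᵐ k ∂μ, 0 < ω k) {b : α → E} (hb : ∀ x : E, AEMeasurable (fun k => inner ℂ x (b k)) μ)
    {g : α → ℝ} {p : ℝ≥0∞} (hg : MemLp g p μ) (hbg : ∀ᵐ k ∂μ, ‖b k‖ ≤ g k) (η : T.domain) :
    MemLp (fun k => inner ℂ (resolvent T (-(ω k : ℂ)) (b k)) (T η)) p μ := by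
  have hsymm : (fun k => inner ℂ (b k) (resolvent T (-(ω k : ℂ)) (T η))) =ᵐ[μ]
      fun k => inner ℂ (resolvent T (-(ω k : ℂ)) (b k)) (T η) := by
    filter_upwards [hpos] with k hk
    exact (hT.isSymmetric_resolvent hk _ _).symm
  refine (MemLp.of_le_mul (c := 2 * ‖(η : E)‖) hg (aestronglyMeasurable_inner_of_weak hb
    (hT.aestronglyMeasurable_resolvent_apply hω hpos (T η))) ?_).ae_eq hsymm
  filter_upwards [hpos, hbg] with k hk hbk
  calc ‖inner ℂ (b k) (resolvent T (-(ω k : ℂ)) (T η))‖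
      ≤ ‖b k‖ * ‖resolvent T (-(ω k : ℂ)) (T η)‖ := norm_inner_le_norm _ _
    _ ≤ ‖g k‖ * (2 * ‖(η : E)‖) := by
        gcongr
        · exact hbk.trans (Real.le_norm_self _)
        · exact hT.norm_resolvent_apply_apply_le hk η
    _ = 2 * ‖(η : E)‖ * ‖g k‖ := mul_comm _ _

end IsNonnegative

end Nonnegative

theorem ae_ne_zero {d : ℕ} (hd : 0 < d) : ∀ᵐ k : Mom d, k ≠ 0 :=
  have : Nonempty (Fin d) := ⟨⟨0, hd⟩⟩
  Measure.ae_ne volume 0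

end BoseField

open BoseField in
theorem mainTheorem4_general {d : ℕ} {E : Type*} [NormedAddCommGroup E] [InnerProductSpace ℂ E]
    [CompleteSpace E] {H : E →ₗ.[ℂ] E} (hself : IsSelfAdjoint H) (hbdd : BddBelow (realSpectrum H))
    {ω : Mom d → ℝ} (hω : AEMeasurable ω) (hpos : ∀ᵐ k, 0 < ω k) {B : Mom d → E →ₗ.[ℂ] E} {Ψ : E}
    (hmeas : ∀ Φ : E, AEMeasurable fun k => inner ℂ Φ (value (B k) Ψ))
    (hBbdd : ∀ᵐ k, IsBoundedOperator (B k))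
    (hBL2 : MemLp (fun k => (opNorm (B k)).toReal) 2 volume) :
    range (hat H) ≤
      (maximalCarleman fun k => resolvent (hat H) (-(ω k : ℂ)) (value (B k) Ψ)).domain := by
  rintro _ ⟨η, rfl⟩
  have hsymm : H.IsFormalAdjoint H := by
    simpa only [LinearPMap.isSelfAdjoint_def.1 hself] using
      LinearPMap.adjoint_isFormalAdjoint hself.dense_domain
  exact (isNonnegative_hat hsymm hbdd).memLp_inner_resolvent_apply hω hpos hmeas
    (hBL2.mul_const ‖Ψ‖) (hBbdd.mono fun k hk => norm_value_le hk.2.ne Ψ) η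

theorem mainTheorem4 {d : ℕ} (hd : 0 < d)
    {𝓗 : Type*} [NormedAddCommGroup 𝓗] [InnerProductSpace ℂ 𝓗] [CompleteSpace 𝓗]
    [TopologicalSpace.SeparableSpace 𝓗]
    (A : 𝓗 →ₗ.[ℂ] 𝓗) (hA : IsSelfAdjoint A) (hAbdd : BoseField.IsBoundedBelow A)
    (ω : BoseField.Mom d → ℝ) (hω : BoseField.IsDispersion ω)
    (HI HQFT : BoseField.Fock d 𝓗 →ₗ.[ℂ] BoseField.Fock d 𝓗)
    (hform : HQFT = BoseField.freeHamiltonian A ω + HI) (hself : IsSelfAdjoint HQFT)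
    (B : BoseField.Mom d → BoseField.Fock d 𝓗 →ₗ.[ℂ] BoseField.Fock d 𝓗)
    (Ψ : BoseField.Fock d 𝓗) (hΨ : BoseField.IsGroundState HQFT Ψ)
    (hPT : BoseField.PullThrough HQFT ω B Ψ)
    (hmeas : BoseField.IsMeasurableFamily (BoseField.freeHamiltonian A ω).domain B)
    (hreg : BoseField.IsRegularAwayFromZero HQFT ω B)
    (hBbdd : ∀ k, k ≠ 0 → BoseField.IsBoundedOperator (B k))
    (hBL2 : MemLp (fun k => (BoseField.opNorm (B k)).toReal) 2 volume) :
    BoseField.range (BoseField.hat HQFT) ≤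
      (BoseField.maximalCarleman (BoseField.carlemanKernel HQFT ω B Ψ)).domain := by
  have hne := BoseField.ae_ne_zero hd
  exact mainTheorem4_general hself hΨ.1 hω.continuous.aemeasurable (hne.mono hω.pos)
    (hmeas.2 Ψ (hform ▸ hΨ.2.2.fst : Ψ ∈ (BoseField.freeHamiltonian A ω + HI).domain).1)
    (hne.mono hBbdd) hBL2
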